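/- **Setting.** Let $\Gamma=\bigcup_{\gamma\in\mathcal E}\gamma([0,1])\subset\mathbb R^N$ be an embedded network: $\mathcal E$ is a finite set of arcs, i.e. $C^1$ injective curves $\gamma:[0,1]\to\mathbb R^N$ with nonvanishing derivative (in particular there are no loops), containing with each $\gamma$ its inverse arc $(-\gamma)(s)=\gamma(1-s)$, and such that $\gamma((0,1))\cap\gamma'([0,1])=\emptyset$ whenever $\gamma\ne\gamma'$ and $\gamma\neq-\gamma'$. The vertices are the points $\gamma(0),\gamma(1)$, $\gamma\in\mathcal E$; $\mathbf V$ denotes their set, and $\Gamma_x=\{\gamma\in\mathcal E:\gamma(1)=x\}$ for $x\in\mathbf V$. The network is connected: any two vertices are linked by a finite concatenation of arcs. For each $\gamma\in\mathcal E$ let $H_\gamma:[0,1]\times\mathbb R\to\mathbb R$ be continuous in $(s,p)$, convex in $p$, coercive in $p$ uniformly in $s$, and such that for every $M>0$ there is $C_M$ with $H_\gamma(s,p)-H_\gamma(s,q)\le C_M|p-q|$ for $s\in[0,1]$, $p,q\in(-M,M)$; assume $H_{-\gamma}(s,p)=H_\gamma(1-s,-p)$. Put $c_\gamma=-\max_{s\in[0,1]}\min_{p\in\mathbb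 R}H_\gamma(s,p)$, and let $x\mapsto c_x$ be a flux limiter, i.e. a function $\mathbf V\to\mathbb R$ with $c_x\le\min_{\gamma\in\Gamma_x}c_\gamma$ for all $x\in\mathbf V$. Let $0\le T_0<T_1\le+\infty$. A $C^1$ function $\varphi$ defined near a point $z$ is a supertangent (resp. subtangent) to $w$ at $z$ if $w-\varphi$ has a local maximum (resp. minimum) at $z$; it is constrained to a set $C\ni z$ if the maximum (resp. minimum) is relative to the intersection of $C$ with a neighborhood of $z$. Write $(u\circ\gamma)(s,t)=u(\gamma(s),t)$, and $\varphi'$, $\varphi_t$ for the derivatives of $\varphi(s,t)$ in $s$ and $t$. A continuous function $u:\Gamma\times[T_0,T_1)\to\mathbb R$ is a *subsolution* of (HJ$\Gamma$) in $(T_0,T_1)$ if 1. for every arc $\gamma$, $u\circ\gamma$ is a viscosity subsolution of $w_t+H_\gamma(s,w')=0$ in $(0,1)\times(T_0,T_1)$, i.e. $\varphi_t+H_\gamma(s,\varphi')\le0$ at every $(s,t)\in(0,1)\times(T_0,T_1)$ for every supertangent $\varphi$ to $u\circ\gamma$ at $(s,t)$; 2. for every $x\in\mathbf V$ and $t_0\in(T_0,T_1)$,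 every supertangent $\psi$ to $u(x,\cdot)$ at $t_0$ satisfies $\frac{d}{dt}\psi(t_0)\le c_x$. A continuous function $v:\Gamma\times[T_0,T_1)\to\mathbb R$ is a *supersolution* of (HJ$\Gamma$) in $(T_0,T_1)$ if 1. for every arc $\gamma$, $v\circ\gamma$ is a viscosity supersolution of $w_t+H_\gamma(s,w')=0$ in $(0,1)\times(T_0,T_1)$, i.e. $\varphi_t+H_\gamma(s,\varphi')\ge0$ at every $(s,t)\in(0,1)\times(T_0,T_1)$ for every subtangent $\varphi$ to $v\circ\gamma$ at $(s,t)$; 2. for every $x\in\mathbf V$ and $t_0\in(T_0,T_1)$, if some subtangent $\phi$ to $v(x,\cdot)$ at $t_0$ satisfies $\frac{d}{dt}\phi(t_0)<c_x$, then there is an arc $\gamma\in\Gamma_x$ such that every subtangent $\varphi$, constrained to $[0,1]\times\overline{(T_0,T_1)}$, to $v\circ\gamma$ at $(1,t_0)$ satisfies $\varphi_t(1,t_0)+H_\gamma(1,\varphi'(1,t_0))\ge0$. **Theorem.** Let $u$ and $v$ be uniformly continuous functions on $\Gamma\times[T_0,T_1)$ which are, respectively, a subsolution and a supersolution of (HJ$\Gamma$)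 in $(T_0,T_1)$. If $u(x,T_0)\le v(x,T_0)$ for all $x\in\Gamma$, then $u\le v$ in $\Gamma\times[T_0,T_1)$. -/

import Mathlib

open Set

namespace HJNetwork

/-- An embedded network in `ℝ^N`: finitely many oriented arcs, indexed by `E`, each of them a
regular simple curve parametrized on `[0,1]` (the values of `curve e` outside `[0,1]` are
irrelevant).  The collection of arcs contains with any arc its inverse arc, the network is
connected and has no loops. -/
structure EmbeddedNetwork (N : ℕ) (E : Type*) where
  finite : Finite E
  curve : E → ℝ → EuclideanSpace ℝ (Fin N)
  contDiffOn : ∀ e, ContDiffOn ℝ 1 (curve e) (Icc 0 1)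
  regular : ∀ e, ∀ s ∈ Icc (0 : ℝ) 1, derivWithin (curve e) (Icc 0 1) s ≠ 0
  /-- simple curves whose initial and terminal points are different -/
  injOn : ∀ e, InjOn (curve e) (Icc 0 1)
  /-- the inverse arc -/
  inv : E → E
  curve_inv : ∀ e, ∀ s ∈ Icc (0 : ℝ) 1, curve (inv e) s = curve e (1 - s)
  /-- the interior of an arc meets no arc other than itself and its inverse -/
  disjoint : ∀ e e', e ≠ e' → e ≠ inv e' →
    Disjoint (curve e '' Ioo 0 1) (curve e' '' Icc 0 1)
  /-- any two endpoints of arcs are linked by a finite concatenation of arcs -/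
  connected : ∀ x y, (∃ e, x = curve e 0 ∨ x = curve e 1) → (∃ e, y = curve e 0 ∨ y = curve e 1) →
    Relation.ReflTransGen (fun a b => ∃ e, curve e 0 = a ∧ curve e 1 = b) x y

/-- The support of the network, as a subset of `ℝ^N`. -/
def EmbeddedNetwork.support {N : ℕ} {E : Type*} (Γ : EmbeddedNetwork N E) :
    Set (EuclideanSpace ℝ (Fin N)) :=
  ⋃ e, Γ.curve e '' Icc 0 1

/-- The vertices: initial and terminal points of the arcs. -/
def EmbeddedNetwork.vertices {N : ℕ} {E : Type*} (Γ : EmbeddedNetwork N E) :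
    Set (EuclideanSpace ℝ (Fin N)) :=
  {x | ∃ e, x = Γ.curve e 0 ∨ x = Γ.curve e 1}

/-- The arcs with terminal point `x`. -/
def EmbeddedNetwork.arcsTo {N : ℕ} {E : Type*} (Γ : EmbeddedNetwork N E)
    (x : EuclideanSpace ℝ (Fin N)) : Set E :=
  {e | Γ.curve e 1 = x}

/-- `H` is a Hamiltonian on the network: a family `H e : [0,1] × ℝ → ℝ` compatible with the
inversion of arcs, each member being continuous, convex in the momentum, coercive in the momentum
uniformly in `s`, and locally Lipschitz in the momentum uniformly in `s`.  The values of `H e s`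
for `s` outside `[0,1]` are irrelevant. -/
structure IsHamiltonian {N : ℕ} {E : Type*} (Γ : EmbeddedNetwork N E) (H : E → ℝ → ℝ → ℝ) :
    Prop where
  inv : ∀ e, ∀ s ∈ Icc (0 : ℝ) 1, ∀ p, H (Γ.inv e) s p = H e (1 - s) (-p)
  continuousOn : ∀ e, ContinuousOn (fun z : ℝ × ℝ => H e z.1 z.2) (Icc 0 1 ×ˢ univ)
  convex : ∀ e, ∀ s ∈ Icc (0 : ℝ) 1, ConvexOn ℝ univ (H e s)
  coercive : ∀ e, ∀ K : ℝ, ∃ R : ℝ, ∀ s ∈ Icc (0 : ℝ) 1, ∀ p, R ≤ |p| → K ≤ H e s p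
  lipschitz : ∀ e, ∀ M > 0, ∃ C : ℝ, ∀ s ∈ Icc (0 : ℝ) 1, ∀ p ∈ Ioo (-M) M, ∀ q ∈ Ioo (-M) M,
    H e s p - H e s q ≤ C * |p - q|

/-- `c_γ = - max_s min_p h(s,p)` for `h = H_γ`, with `s` ranging in `[0,1]`.  (For a continuous `h`
coercive in `p` uniformly in `s`, the infimum and the supremum are attained.) -/
noncomputable def arcBound (h : ℝ → ℝ → ℝ) : ℝ :=
  -(⨆ s : Icc (0 : ℝ) 1, ⨅ p : ℝ, h s p)

/-- `c` is a flux limiter: `c_x ≤ min_{γ ∈ Γ_x} c_γ` at any vertex `x`.  The values of `c` outside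
the vertices are irrelevant. -/
def IsFluxLimiter {N : ℕ} {E : Type*} (Γ : EmbeddedNetwork N E) (H : E → ℝ → ℝ → ℝ)
    (c : EuclideanSpace ℝ (Fin N) → ℝ) : Prop :=
  ∀ x ∈ Γ.vertices, ∀ e ∈ Γ.arcsTo x, c x ≤ arcBound (H e)

/-- The time interval `(T₀,T₁)`, where `T₁` may be `+∞`. -/
def openTime (T₀ : ℝ) (T₁ : EReal) : Set ℝ := {t | T₀ < t ∧ (t : EReal) < T₁}

/-- The time interval `[T₀,T₁)`, where `T₁` may be `+∞`. -/
def halfOpenTime (T₀ : ℝ) (T₁ : EReal) : Set ℝ := {t | T₀ ≤ t ∧ (t : EReal) < T₁}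

/-- `φ` is a `C¹` supertangent to `w` at `z`, constrained to `C`: it is `C¹` around `z`, and `w - φ`
has at `z` a maximum relative to the intersection of `C` with a neighborhood of `z`. -/
def IsSupertangentOn {X : Type*} [NormedAddCommGroup X] [NormedSpace ℝ X] (w φ : X → ℝ) (C : Set X)
    (z : X) : Prop :=
  ContDiffAt ℝ 1 φ z ∧ IsLocalMaxOn (fun y => w y - φ y) C z

/-- `φ` is a `C¹` subtangent to `w` at `z`, constrained to `C`. -/
def IsSubtangentOn {X : Type*} [NormedAddCommGroup X] [NormedSpace ℝ X] (w φ : X → ℝ) (C : Set X)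
    (z : X) : Prop :=
  ContDiffAt ℝ 1 φ z ∧ IsLocalMinOn (fun y => w y - φ y) C z

/-- The space derivative `φ'` at `z = (s,t)`. -/
noncomputable def spaceDeriv (φ : ℝ × ℝ → ℝ) (z : ℝ × ℝ) : ℝ := deriv (fun s => φ (s, z.2)) z.1

/-- The time derivative `φ_t` at `z = (s,t)`. -/
noncomputable def timeDeriv (φ : ℝ × ℝ → ℝ) (z : ℝ × ℝ) : ℝ := deriv (fun t => φ (z.1, t)) z.2

/-- `w` is a viscosity subsolution of `w_t + h(s,w') = 0` in `(0,1) × (T₀,T₁)`. -/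
def IsViscositySubsolution (h : ℝ → ℝ → ℝ) (T₀ : ℝ) (T₁ : EReal) (w : ℝ × ℝ → ℝ) : Prop :=
  ∀ z ∈ Ioo (0 : ℝ) 1 ×ˢ openTime T₀ T₁, ∀ φ : ℝ × ℝ → ℝ,
    IsSupertangentOn w φ (Ioo 0 1 ×ˢ openTime T₀ T₁) z →
      timeDeriv φ z + h z.1 (spaceDeriv φ z) ≤ 0

/-- `w` is a viscosity supersolution of `w_t + h(s,w') = 0` in `(0,1) × (T₀,T₁)`. -/
def IsViscositySupersolution (h : ℝ → ℝ → ℝ) (T₀ : ℝ) (T₁ : EReal) (w : ℝ × ℝ → ℝ) : Prop :=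
  ∀ z ∈ Ioo (0 : ℝ) 1 ×ˢ openTime T₀ T₁, ∀ φ : ℝ × ℝ → ℝ,
    IsSubtangentOn w φ (Ioo 0 1 ×ˢ openTime T₀ T₁) z →
      0 ≤ timeDeriv φ z + h z.1 (spaceDeriv φ z)

/-- The function `u ∘ γ`, `(s,t) ↦ u(γ(s),t)`. -/
def alongArc {N : ℕ} {E : Type*} (Γ : EmbeddedNetwork N E)
    (u : EuclideanSpace ℝ (Fin N) × ℝ → ℝ) (e : E) : ℝ × ℝ → ℝ :=
  fun z => u (Γ.curve e z.1, z.2)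

/-- Subsolutions on the network with flux limiter `c` in `(T₀,T₁)`.  Only the values of `u` on
`Γ × [T₀,T₁)` matter. -/
structure IsSubsolution {N : ℕ} {E : Type*} (Γ : EmbeddedNetwork N E) (H : E → ℝ → ℝ → ℝ)
    (c : EuclideanSpace ℝ (Fin N) → ℝ) (T₀ : ℝ) (T₁ : EReal)
    (u : EuclideanSpace ℝ (Fin N) × ℝ → ℝ) : Prop where
  continuousOn : ContinuousOn u (Γ.support ×ˢ halfOpenTime T₀ T₁)
  arc : ∀ e, IsViscositySubsolution (H e) T₀ T₁ (alongArc Γ u e)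
  vertex : ∀ x ∈ Γ.vertices, ∀ t₀ ∈ openTime T₀ T₁, ∀ ψ : ℝ → ℝ,
    IsSupertangentOn (fun t => u (x, t)) ψ (openTime T₀ T₁) t₀ → deriv ψ t₀ ≤ c x

/-- Supersolutions on the network with flux limiter `c` in `(T₀,T₁)`.  Only the values of `v` on
`Γ × [T₀,T₁)` matter. -/
structure IsSupersolution {N : ℕ} {E : Type*} (Γ : EmbeddedNetwork N E) (H : E → ℝ → ℝ → ℝ)
    (c : EuclideanSpace ℝ (Fin N) → ℝ) (T₀ : ℝ) (T₁ : EReal)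
    (v : EuclideanSpace ℝ (Fin N) × ℝ → ℝ) : Prop where
  continuousOn : ContinuousOn v (Γ.support ×ˢ halfOpenTime T₀ T₁)
  arc : ∀ e, IsViscositySupersolution (H e) T₀ T₁ (alongArc Γ v e)
  vertex : ∀ x ∈ Γ.vertices, ∀ t₀ ∈ openTime T₀ T₁,
    (∃ ψ : ℝ → ℝ, IsSubtangentOn (fun t => v (x, t)) ψ (openTime T₀ T₁) t₀ ∧ deriv ψ t₀ < c x) →
      ∃ e ∈ Γ.arcsTo x, ∀ φ : ℝ × ℝ → ℝ,
        IsSubtangentOn (alongArc Γ v e) φ (Icc 0 1 ×ˢ closure (openTime T₀ T₁)) (1, t₀) →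
          0 ≤ timeDeriv φ (1, t₀) + H e 1 (spaceDeriv φ (1, t₀))

end HJNetwork

/-!
Comparison for viscosity sub- and supersolutions on a network, by doubling of variables.

If `u ≤ v` fails, one maximizes
`Φ (x, r₁, r₂) = u (x, r₁) - v (x, r₂) - k (r₁ - r₂)² - θ r₁`
over the compact set `Γ × [T₀, T]²`, for some `T < T₁`.  Only the time variable is doubled, and the
constant `k` is large but *fixed*; `θ` is an increasing exponential, which makes `u - θ` a strict
subsolution and keeps the maximum away from the terminal time.  The initial inequality keeps it away
from the initial time.  Write `(x₀, τ, t)` for a maximum point and `q = 2 k (τ - t)`.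

* If `x₀` is an interior point of an arc (`false_of_interior_max`), the space variable is doubled as
  well, with a penalization `K (s - s')²`, `K → ∞`.  Since `k` does not move, the time derivatives
  stay bounded, hence so does the momentum by coercivity and the subsolution inequality; the
  continuity of the Hamiltonian then suffices to reach a contradiction.
* If `x₀` is a vertex, the subsolution condition gives `q + θ' τ ≤ c x₀`, so that `v (x₀, ·)` has
  at `t` a subtangent with derivative `q < c x₀`, and the supersolution condition holds at
  `(x₀, t)` on some arc ending at `x₀`.  It is violated by an explicit subtangent
  (`exists_subtangent_of_vertex_max`): the bound on the flux limiter provides a momentum `b` on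
  the increasing branch of `H 1` with `-q - θ' τ < H 1 b < -q`.  The function `v` lies above the
  sup-convolution in time of `u - θ`, up to a constant, and this sup-convolution is, near the
  vertex, a viscosity subsolution of `w' ≤ b`, so that its increments in `s` are at most `b` times
  the increment of `s` (`exists_le_add_mul_of_slope_le`).

The sup-convolution never appears as a function: only its maximizers are used.
-/

open Filter Topology

namespace HJNetwork

/-! ### Viscosity bounds on the slope -/

/-- A function `W s = max_{r ∈ J} F (s, r)` which satisfies `W' ≤ b` in the viscosity sense in
`(a, c)` satisfies `W c - W a ≤ b (c - a)`.  The partial maximum `W` does not appear explicitly: the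
test functions are tested at the maximum points of `F (s, r) - g s`. -/
theorem exists_le_add_mul_of_slope_le {a c b : ℝ} (hac : a < c) {J : Set ℝ} (hJ : IsCompact J)
    {F : ℝ × ℝ → ℝ} (hF : ContinuousOn F (Icc a c ×ˢ J))
    (hslope : ∀ S ∈ Ioo a c, ∀ g : ℝ → ℝ, ContDiff ℝ 1 g → ∀ z ∈ Ioo a S ×ˢ J,
      IsMaxOn (fun y : ℝ × ℝ => F y - g y.1) (Icc a S ×ˢ J) z → deriv g z.1 ≤ b)
    {r : ℝ} (hr : r ∈ J) :
    ∃ r' ∈ J, F (c, r) - b * (c - a) ≤ F (a, r') := by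
  by_contra! hcon
  -- the maximum of `F (a, ·)` is strictly below the claimed bound
  obtain ⟨r₀, hr₀, hmax₀⟩ := hJ.exists_isMaxOn ⟨r, hr⟩
    (f := fun r' => F (a, r')) (hF.comp (by fun_prop) fun r' hr' => ⟨⟨le_rfl, hac.le⟩, hr'⟩)
  set μ := F (a, r₀) with hμ
  have hμlt : μ < F (c, r) - b * (c - a) := hcon r₀ hr₀
  obtain ⟨b', hb', hμ'⟩ : ∃ b' > b, μ < F (c, r) - b' * (c - a) := by
    have h1 : ∀ᶠ b' in 𝓝[>] b, μ < F (c, r) - b' * (c - a) :=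
      ((by fun_prop : Continuous fun b' : ℝ => F (c, r) - b' * (c - a)).continuousAt.eventually_const_lt
        hμlt).filter_mono nhdsWithin_le_nhds
    obtain ⟨b', h2, h3⟩ := (h1.and self_mem_nhdsWithin).exists
    exact ⟨b', h3, h2⟩
  obtain ⟨s₂, hs₂, hμ₂⟩ : ∃ s₂ ∈ Ioo a c, μ < F (s₂, r) - b' * (s₂ - a) := by
    have hc : ContinuousWithinAt (fun s => F (s, r) - b' * (s - a)) (Icc a c) c := by
      have : ContinuousOn (fun s => F (s, r) - b' * (s - a)) (Icc a c) :=
        (hF.comp (by fun_prop) fun s hs => ⟨hs, hr⟩).sub (by fun_prop)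
      exact this c ⟨hac.le, le_rfl⟩
    have h1 := (hc.mono Ioo_subset_Icc_self).eventually_const_lt hμ'
    have : (𝓝[Ioo a c] c).NeBot := by
      rw [nhdsWithin_Ioo_eq_nhdsLT hac]; infer_instance
    obtain ⟨s, h2, h3⟩ := (h1.and self_mem_nhdsWithin).exists
    exact ⟨s, h3, h2⟩
  obtain ⟨S, hS₂, hSc⟩ := exists_between hs₂.2
  have haS : a < S := hs₂.1.trans hS₂
  have hsub : Icc a S ×ˢ J ⊆ Icc a c ×ˢ J := prod_mono (Icc_subset_Icc_right hSc.le) le_rfl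
  obtain ⟨B, hB⟩ := ((isCompact_Icc.prod hJ).image_of_continuousOn hF).bddAbove
  have hB' : ∀ s ∈ Icc a c, ∀ r ∈ J, F (s, r) ≤ B := fun s hs r hr => hB ⟨(s, r), ⟨hs, hr⟩, rfl⟩
  set κ := (F (s₂, r) - b' * (s₂ - a) - μ) / 2 with hκ
  have hκ0 : 0 < κ := by rw [hκ]; linarith
  -- the barrier `κ exp (A (s - s₂))` is small at `s₂` and dominates at `S`
  obtain ⟨A, hA0, hA⟩ : ∃ A : ℝ, 0 < A ∧ B - b' * (S - a) - μ < κ * Real.exp (A * (S - s₂)) := by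
    refine ⟨(|B - b' * (S - a) - μ| + 1) / (κ * (S - s₂)), ?_, ?_⟩
    · have : 0 < S - s₂ := by linarith
      positivity
    · have h0 : 0 < S - s₂ := by linarith
      have h1 : (|B - b' * (S - a) - μ| + 1) / (κ * (S - s₂)) * (S - s₂)
          = (|B - b' * (S - a) - μ| + 1) / κ := by field_simp
      rw [h1]
      have h2 := Real.add_one_le_exp ((|B - b' * (S - a) - μ| + 1) / κ)
      have h3 : κ * ((|B - b' * (S - a) - μ| + 1) / κ) = |B - b' * (S - a) - μ| + 1 := by
        field_simp
      have h4 := mul_le_mul_of_nonneg_left h2 hκ0.le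
      have h5 := le_abs_self (B - b' * (S - a) - μ)
      linarith
  set g : ℝ → ℝ := fun s => b' * (s - a) + κ * Real.exp (A * (s - s₂)) with hg
  have hgC : ContDiff ℝ 1 g := by fun_prop
  have hgd : ∀ s, deriv g s = b' + κ * (Real.exp (A * (s - s₂)) * A) := by
    intro s
    have h1 : HasDerivAt (fun s => A * (s - s₂)) A s := by
      simpa using ((hasDerivAt_id s).sub_const s₂).const_mul A
    have h2 : HasDerivAt (fun s => b' * (s - a)) b' s := by
      simpa using ((hasDerivAt_id s).sub_const a).const_mul b'
    exact (h2.add (h1.exp.const_mul κ)).deriv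
  obtain ⟨z, hz, hzmax⟩ := (isCompact_Icc.prod hJ).exists_isMaxOn
    (⟨(s₂, r), ⟨hs₂.1.le, hS₂.le⟩, hr⟩ : (Icc a S ×ˢ J).Nonempty)
    (f := fun y : ℝ × ℝ => F y - g y.1) ((hF.mono hsub).sub (by fun_prop))
  have hval : μ < F z - g z.1 := by
    have h1 : F (s₂, r) - g s₂ ≤ F z - g z.1 := hzmax ⟨⟨hs₂.1.le, hS₂.le⟩, hr⟩
    have h2 : g s₂ = b' * (s₂ - a) + κ := by simp [hg]
    rw [h2] at h1
    linarith
  obtain ⟨s, r₁⟩ := z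
  obtain ⟨⟨hs1, hs2⟩, hr₁⟩ := hz
  simp only at hs1 hs2 hr₁ hval
  have hs1' : a < s := by
    rcases hs1.lt_or_eq with h | h
    · exact h
    · subst h
      have h1 : F (a, r₁) ≤ μ := hmax₀ hr₁
      have h2 : 0 ≤ g a := by simp only [hg, sub_self, mul_zero, zero_add]; positivity
      linarith
  have hs2' : s < S := by
    rcases hs2.lt_or_eq with h | h
    · exact h
    · subst h
      have h1 := hB' s ⟨hs1, hSc.le⟩ r₁ hr₁
      simp only [hg] at hval
      linarith
  have := hslope S ⟨haS, hSc⟩ g hgC (s, r₁) ⟨⟨hs1', hs2'⟩, hr₁⟩ hzmax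
  rw [hgd] at this
  have h3 : 0 < κ * (Real.exp (A * (s - s₂)) * A) := by positivity
  simp only at this
  linarith

/-! ### Time intervals -/

theorem mem_openTime_of_mem_Ioo {T₀ T : ℝ} {T₁ : EReal} (hT : (T : EReal) < T₁) {t : ℝ}
    (ht : t ∈ Ioo T₀ T) : t ∈ openTime T₀ T₁ :=
  ⟨ht.1, (EReal.coe_lt_coe_iff.2 ht.2).trans hT⟩

theorem Icc_subset_halfOpenTime {T₀ T : ℝ} {T₁ : EReal} (hT : (T : EReal) < T₁) :
    Icc T₀ T ⊆ halfOpenTime T₀ T₁ :=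
  fun _ ht => ⟨ht.1, (EReal.coe_le_coe_iff.2 ht.2).trans_lt hT⟩

/-! ### Maxima at interior points of an arc -/

theorem hasDerivAt_mul_sub_sq (k a x : ℝ) :
    HasDerivAt (fun y : ℝ => k * (y - a) ^ 2) (2 * k * (x - a)) x := by
  have := (((hasDerivAt_id x).sub_const a).pow 2).const_mul k
  refine this.congr_deriv ?_
  simp
  ring

/-- The function `U (s, r₁) - V (s, r₂) - k (r₁ - r₂)² - θ r₁`, where `U` is a subsolution, `V` a
supersolution and `θ` is strictly increasing, has no maximum at an interior point of the arc.  No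
modulus of continuity of `h` that is uniform in the momentum is needed, since the momenta which come
up in the doubling of `s` range in a bounded set. -/
theorem false_of_interior_max {h : ℝ → ℝ → ℝ}
    (hcont : ContinuousOn (fun z : ℝ × ℝ => h z.1 z.2) (Icc 0 1 ×ˢ univ))
    (hcoer : ∀ K : ℝ, ∃ R : ℝ, ∀ s ∈ Icc (0 : ℝ) 1, ∀ p, R ≤ |p| → K ≤ h s p)
    {T₀ T : ℝ} {T₁ : EReal} (hT : (T : EReal) < T₁) {U V : ℝ × ℝ → ℝ}
    (hUc : ContinuousOn U (Icc 0 1 ×ˢ Icc T₀ T)) (hVc : ContinuousOn V (Icc 0 1 ×ˢ Icc T₀ T))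
    (hU : IsViscositySubsolution h T₀ T₁ U) (hV : IsViscositySupersolution h T₀ T₁ V)
    {θ : ℝ → ℝ} (hθ : ContDiff ℝ 1 θ) {σ : ℝ} (hσ : 0 < σ)
    (hθσ : ∀ r ∈ Icc T₀ T, σ ≤ deriv θ r) {k : ℝ} (hk : 0 < k)
    {s₀ τ t : ℝ} (hs₀ : s₀ ∈ Ioo (0 : ℝ) 1) (hτ : τ ∈ Ioo T₀ T) (ht : t ∈ Ioo T₀ T)
    (hmax : ∀ s ∈ Icc (0 : ℝ) 1, ∀ r₁ ∈ Icc T₀ T, ∀ r₂ ∈ Icc T₀ T,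
      U (s, r₁) - V (s, r₂) - k * (r₁ - r₂) ^ 2 - θ r₁ ≤
        U (s₀, τ) - V (s₀, t) - k * (τ - t) ^ 2 - θ τ) : False := by
  set M := U (s₀, τ) - V (s₀, t) - k * (τ - t) ^ 2 - θ τ with hM
  have hT0 : T₀ < T := hτ.1.trans hτ.2
  -- a priori bound for the momentum at the maximum points, uniform in the penalization in `s`
  obtain ⟨R, hR⟩ := hcoer (2 * k * (T - T₀) + 1)
  have hKc : IsCompact (Icc (0 : ℝ) 1 ×ˢ Icc (-(R + 1)) (R + 1)) := isCompact_Icc.prod isCompact_Icc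
  obtain ⟨η₁, hη₁, hunif⟩ := Metric.uniformContinuousOn_iff.1
    (hKc.uniformContinuousOn_of_continuous (hcont.mono (prod_mono le_rfl (subset_univ _))))
    (σ / 4) (by positivity)
  -- localization scale
  obtain ⟨η, hη0, hη1, hησ, hηη₁, hηs, hηs', hητ, hητ', hηt, hηt'⟩ : ∃ η > 0, η ≤ 1 / 4 ∧
      η ≤ σ / 16 ∧ η < η₁ / 2 ∧ 2 * η < s₀ ∧ 2 * η < 1 - s₀ ∧ η < τ - T₀ ∧ η < T - τ ∧ η < t - T₀ ∧
      η < T - t := by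
    have e : ∀ x : ℝ, 0 < x → ∀ᶠ η in 𝓝[>] (0 : ℝ), η < x := fun x hx =>
      (eventually_lt_nhds hx).filter_mono nhdsWithin_le_nhds
    obtain ⟨η, h⟩ := ((((((((((e (1/4) (by norm_num)).and (e (σ/16) (by positivity))).and
      (e (η₁/2) (by positivity))).and (e (s₀/2) (by linarith [hs₀.1]))).and
      (e ((1-s₀)/2) (by linarith [hs₀.2]))).and (e (τ - T₀) (by linarith [hτ.1]))).and
      (e (T - τ) (by linarith [hτ.2]))).and (e (t - T₀) (by linarith [ht.1]))).and
      (e (T - t) (by linarith [ht.2]))).and self_mem_nhdsWithin).exists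
    obtain ⟨⟨⟨⟨⟨⟨⟨⟨⟨h1, h2⟩, h3⟩, h4⟩, h5⟩, h6⟩, h7⟩, h8⟩, h9⟩, h10⟩ := h
    exact ⟨η, h10, h1.le, h2.le, h3, by linarith, by linarith, h6, h7, h8, h9⟩
  have hcI : IsCompact (Icc (0 : ℝ) 1 ×ˢ Icc T₀ T) := isCompact_Icc.prod isCompact_Icc
  obtain ⟨ρ, hρ, hVu⟩ := Metric.uniformContinuousOn_iff.1
    (hcI.uniformContinuousOn_of_continuous hVc) (η ^ 2) (by positivity)
  obtain ⟨BU, hBU⟩ := (hcI.image_of_continuousOn (hUc.sub (hθ.continuous.comp_continuousOn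
    continuousOn_snd))).bddAbove
  obtain ⟨BV, hBV⟩ := (hcI.image_of_continuousOn hVc).bddBelow
  -- the penalization `K (s - s')²` forces `|s - s'| < min ρ η`
  obtain ⟨ρ', hρ'0, hρ'ρ, hρ'η⟩ : ∃ ρ' > 0, ρ' ≤ ρ ∧ ρ' ≤ η :=
    ⟨min ρ η, lt_min hρ hη0, min_le_left _ _, min_le_right _ _⟩
  set K := (|BU - BV - M| + 1) / ρ' ^ 2 with hK
  have hK0 : 0 < K := by positivity
  have hcD : IsCompact ((Icc (0 : ℝ) 1 ×ˢ Icc T₀ T) ×ˢ (Icc (0 : ℝ) 1 ×ˢ Icc T₀ T)) := hcI.prod hcI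
  have hτI : τ ∈ Icc T₀ T := Ioo_subset_Icc_self hτ
  have htI : t ∈ Icc T₀ T := Ioo_subset_Icc_self ht
  have hs₀I : s₀ ∈ Icc (0 : ℝ) 1 := Ioo_subset_Icc_self hs₀
  obtain ⟨⟨⟨s, r₁⟩, ⟨s', r₂⟩⟩, ⟨⟨hs, hr₁⟩, ⟨hs', hr₂⟩⟩, hz⟩ := hcD.exists_isMaxOn
    ⟨((s₀, τ), (s₀, t)), ⟨hs₀I, hτI⟩, ⟨hs₀I, htI⟩⟩
    (f := fun z : (ℝ × ℝ) × (ℝ × ℝ) => U z.1 - V z.2 - (k * (z.1.2 - z.2.2) ^ 2 + θ z.1.2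
      + K * (z.1.1 - z.2.1) ^ 2 + (z.1.1 - s₀) ^ 2 + (z.1.2 - τ) ^ 2 + (z.2.2 - t) ^ 2))
    (((hUc.comp continuousOn_fst fun z hz => hz.1).sub
      (hVc.comp continuousOn_snd fun z hz => hz.2)).sub
      (by have := hθ.continuous; fun_prop))
  have hz' : ∀ a ∈ Icc (0 : ℝ) 1, ∀ b ∈ Icc T₀ T, ∀ a' ∈ Icc (0 : ℝ) 1, ∀ b' ∈ Icc T₀ T,
      U (a, b) - V (a', b') - (k * (b - b') ^ 2 + θ b
      + K * (a - a') ^ 2 + (a - s₀) ^ 2 + (b - τ) ^ 2 + (b' - t) ^ 2) ≤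
      U (s, r₁) - V (s', r₂) - (k * (r₁ - r₂) ^ 2 + θ r₁
      + K * (s - s') ^ 2 + (s - s₀) ^ 2 + (r₁ - τ) ^ 2 + (r₂ - t) ^ 2) :=
    fun a ha b hb a' ha' b' hb' =>
      isMaxOn_iff.1 hz ((a, b), (a', b')) ⟨⟨ha, hb⟩, ⟨ha', hb'⟩⟩
  clear hz
  simp only at hs hr₁ hs' hr₂
  have hge : M ≤ U (s, r₁) - V (s', r₂) - (k * (r₁ - r₂) ^ 2 + θ r₁
      + K * (s - s') ^ 2 + (s - s₀) ^ 2 + (r₁ - τ) ^ 2 + (r₂ - t) ^ 2) := by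
    have := hz' s₀ hs₀I τ hτI s₀ hs₀I t htI
    simp only [sub_self] at this
    rw [hM]; linarith
  have hss' : |s - s'| < ρ' := by
    have h1 : U (s, r₁) - θ r₁ ≤ BU := hBU ⟨(s, r₁), ⟨hs, hr₁⟩, rfl⟩
    have h2 : BV ≤ V (s', r₂) := hBV ⟨(s', r₂), ⟨hs', hr₂⟩, rfl⟩
    have h3 : K * (s - s') ^ 2 ≤ BU - BV - M := by
      have := mul_nonneg hk.le (sq_nonneg (r₁ - r₂))
      linarith [sq_nonneg (s - s₀), sq_nonneg (r₁ - τ), sq_nonneg (r₂ - t)]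
    have h4 : K * ρ' ^ 2 = |BU - BV - M| + 1 := by rw [hK]; field_simp
    have h5 := le_abs_self (BU - BV - M)
    have h6 : (s - s') ^ 2 < ρ' ^ 2 := lt_of_mul_lt_mul_left (by linarith) hK0.le
    exact abs_lt_of_sq_lt_sq h6 hρ'0.le
  have hloc : (s - s₀) ^ 2 + (r₁ - τ) ^ 2 + (r₂ - t) ^ 2 < η ^ 2 := by
    have h1 : dist (V (s, r₂)) (V (s', r₂)) < η ^ 2 := by
      refine hVu _ ⟨hs, hr₂⟩ _ ⟨hs', hr₂⟩ ?_
      rw [Prod.dist_eq, dist_self, Real.dist_eq]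
      exact max_lt (hss'.trans_le hρ'ρ) hρ
    rw [Real.dist_eq, abs_lt] at h1
    have h2 := hmax s hs r₁ hr₁ r₂ hr₂
    have h3 := mul_nonneg hK0.le (sq_nonneg (s - s'))
    linarith [h1.2]
  have hsη : |s - s₀| < η := abs_lt_of_sq_lt_sq
    (by linarith [sq_nonneg (r₁ - τ), sq_nonneg (r₂ - t)]) hη0.le
  have hr₁η : |r₁ - τ| < η := abs_lt_of_sq_lt_sq
    (by linarith [sq_nonneg (s - s₀), sq_nonneg (r₂ - t)]) hη0.le
  have hr₂η : |r₂ - t| < η := abs_lt_of_sq_lt_sq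
    (by linarith [sq_nonneg (s - s₀), sq_nonneg (r₁ - τ)]) hη0.le
  have hss'η : |s - s'| < η := hss'.trans_le hρ'η
  rw [abs_lt] at hsη hr₁η hr₂η hss'η
  have hsO : s ∈ Ioo (0 : ℝ) 1 := ⟨by linarith, by linarith⟩
  have hs'O : s' ∈ Ioo (0 : ℝ) 1 := ⟨by linarith, by linarith⟩
  have hr₁O : r₁ ∈ Ioo T₀ T := ⟨by linarith, by linarith⟩
  have hr₂O : r₂ ∈ Ioo T₀ T := ⟨by linarith, by linarith⟩
  have hsub := hU (s, r₁) ⟨hsO, mem_openTime_of_mem_Ioo hT hr₁O⟩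
    (fun y => k * (y.2 - r₂) ^ 2 + θ y.2 + K * (y.1 - s') ^ 2 + (y.1 - s₀) ^ 2 + (y.2 - τ) ^ 2)
    ⟨by have := hθ.comp (contDiff_snd (E := ℝ) (F := ℝ)); exact ContDiff.contDiffAt (by fun_prop), by
      refine Filter.Eventually.filter_mono nhdsWithin_le_nhds ?_
      filter_upwards [prod_mem_nhds (Icc_mem_nhds hsO.1 hsO.2) (Icc_mem_nhds hr₁O.1 hr₁O.2)]
        with y hy
      have := hz' y.1 hy.1 y.2 hy.2 s' hs' r₂ hr₂
      simp only [Prod.mk.eta] at this ⊢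
      linarith⟩
  have hsup := hV (s', r₂) ⟨hs'O, mem_openTime_of_mem_Ioo hT hr₂O⟩
    (fun y => -(k * (r₁ - y.2) ^ 2) - K * (s - y.1) ^ 2 - (y.2 - t) ^ 2)
    ⟨ContDiff.contDiffAt (by fun_prop), by
      refine Filter.Eventually.filter_mono nhdsWithin_le_nhds ?_
      filter_upwards [prod_mem_nhds (Icc_mem_nhds hs'O.1 hs'O.2) (Icc_mem_nhds hr₂O.1 hr₂O.2)]
        with y hy
      have := hz' s hs r₁ hr₁ y.1 hy.1 y.2 hy.2
      simp only [Prod.mk.eta] at this ⊢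
      linarith⟩
  have hsp : HasDerivAt (fun a : ℝ => k * (r₁ - r₂) ^ 2 + θ r₁ + K * (a - s') ^ 2 + (a - s₀) ^ 2
      + (r₁ - τ) ^ 2) (2 * K * (s - s') + 2 * (s - s₀)) s := by
    have := (((hasDerivAt_mul_sub_sq K s' s).const_add (k * (r₁ - r₂) ^ 2 + θ r₁)).add
      (hasDerivAt_mul_sub_sq 1 s₀ s)).add_const ((r₁ - τ) ^ 2)
    simpa using this
  have htm : HasDerivAt (fun b : ℝ => k * (b - r₂) ^ 2 + θ b + K * (s - s') ^ 2 + (s - s₀) ^ 2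
      + (b - τ) ^ 2) (2 * k * (r₁ - r₂) + deriv θ r₁ + 2 * (r₁ - τ)) r₁ := by
    have hd : HasDerivAt θ (deriv θ r₁) r₁ :=
      (hθ.differentiable one_ne_zero).differentiableAt.hasDerivAt
    have := ((((hasDerivAt_mul_sub_sq k r₂ r₁).add hd).add_const (K * (s - s') ^ 2)).add_const
      ((s - s₀) ^ 2)).fun_add (hasDerivAt_mul_sub_sq 1 τ r₁)
    simpa using this
  have hsp' : HasDerivAt (fun a : ℝ => -(k * (r₁ - r₂) ^ 2) - K * (s - a) ^ 2 - (r₂ - t) ^ 2)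
      (2 * K * (s - s')) s' := by
    have := ((hasDerivAt_mul_sub_sq K s s').const_sub (-(k * (r₁ - r₂) ^ 2))).sub_const
      ((r₂ - t) ^ 2)
    refine (this.congr_deriv (by ring)).congr_of_eventuallyEq (.of_forall fun a => ?_)
    simp only; ring
  have htm' : HasDerivAt (fun b : ℝ => -(k * (r₁ - b) ^ 2) - K * (s - s') ^ 2 - (b - t) ^ 2)
      (2 * k * (r₁ - r₂) - 2 * (r₂ - t)) r₂ := by
    have := ((hasDerivAt_mul_sub_sq k r₁ r₂).neg.sub_const (K * (s - s') ^ 2)).sub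
      (hasDerivAt_mul_sub_sq 1 t r₂)
    refine (this.congr_deriv (by ring)).congr_of_eventuallyEq (.of_forall fun a => ?_)
    simp only [Pi.sub_apply, Pi.neg_apply]; ring
  simp only [timeDeriv, spaceDeriv] at hsub hsup
  rw [htm.deriv, hsp.deriv] at hsub
  rw [htm'.deriv, hsp'.deriv] at hsup
  have hθr := hθσ r₁ hr₁
  have hq : -(2 * k * (T - T₀)) ≤ 2 * k * (r₁ - r₂) := by
    nlinarith [hr₁.1, hr₂.2]
  have hP : |2 * K * (s - s') + 2 * (s - s₀)| < R := by
    by_contra! hcon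
    have := hR s hs _ hcon
    linarith
  rw [abs_lt] at hP
  have hclose := hunif (s', 2 * K * (s - s')) ⟨hs', by constructor <;> linarith⟩
    (s, 2 * K * (s - s') + 2 * (s - s₀)) ⟨hs, by constructor <;> linarith⟩ (by
      rw [Prod.dist_eq, Real.dist_eq, Real.dist_eq]
      refine max_lt ?_ ?_ <;> rw [abs_lt] <;> constructor <;> simp only <;> linarith)
  rw [Real.dist_eq, abs_lt] at hclose
  simp only at hclose
  linarith [hclose.2]

/-! ### Maxima at a vertex -/

/-- If `U (s, r₁) - V (s, r₂) - k (r₁ - r₂)² - θ r₁` has a maximum at `s = 1`, `(r₁, r₂) = (τ, t)`,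
where `U` is a subsolution inside the arc, then `V` has at `(1, t)` a constrained subtangent
violating the supersolution inequality.  The subtangent is `-k (r - τ)² - b (1 - s)`, where
`b` dominates the slopes of `U` near the vertex, and yet `2 k (τ - t) + h 1 b < 0`. -/
theorem exists_subtangent_of_vertex_max {h : ℝ → ℝ → ℝ}
    (hcont : ContinuousOn (fun z : ℝ × ℝ => h z.1 z.2) (Icc 0 1 ×ˢ univ))
    (hconv : ∀ s ∈ Icc (0 : ℝ) 1, ConvexOn ℝ univ (h s))
    (hcoer : ∀ K : ℝ, ∃ R : ℝ, ∀ s ∈ Icc (0 : ℝ) 1, ∀ p, R ≤ |p| → K ≤ h s p)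
    {T₀ T : ℝ} {T₁ : EReal} (hT : (T : EReal) < T₁) {U V : ℝ × ℝ → ℝ}
    (hUc : ContinuousOn U (Icc 0 1 ×ˢ Icc T₀ T)) (hU : IsViscositySubsolution h T₀ T₁ U)
    {θ : ℝ → ℝ} (hθ : ContDiff ℝ 1 θ) {k : ℝ} (hk : 0 < k)
    {τ t : ℝ} (hτ : τ ∈ Ioo T₀ T) (ht : t ∈ Ioo T₀ T) (hθτ : 0 < deriv θ τ)
    (hmin : ⨅ p, h 1 p ≤ -(2 * k * (τ - t) + deriv θ τ))
    (hmax : ∀ s ∈ Icc (0 : ℝ) 1, ∀ r₁ ∈ Icc T₀ T, ∀ r₂ ∈ Icc T₀ T,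
      U (s, r₁) - V (s, r₂) - k * (r₁ - r₂) ^ 2 - θ r₁ ≤
        U (1, τ) - V (1, t) - k * (τ - t) ^ 2 - θ τ) :
    ∃ φ : ℝ × ℝ → ℝ, IsSubtangentOn V φ (Icc 0 1 ×ˢ closure (openTime T₀ T₁)) (1, t) ∧
      timeDeriv φ (1, t) + h 1 (spaceDeriv φ (1, t)) < 0 := by
  set σ := deriv θ τ with hσ
  set q := 2 * k * (τ - t) with hq
  have hT0 : T₀ < T := hτ.1.trans hτ.2
  have hτI : τ ∈ Icc T₀ T := Ioo_subset_Icc_self hτ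
  have htI : t ∈ Icc T₀ T := Ioo_subset_Icc_self ht
  have h1I : (1 : ℝ) ∈ Icc (0 : ℝ) 1 := ⟨zero_le_one, le_rfl⟩
  have hp : ∀ s ∈ Icc (0 : ℝ) 1, Continuous (h s) := fun s hs =>
    hcont.comp_continuous (f := fun p : ℝ => (s, p)) (by fun_prop) fun p => ⟨hs, trivial⟩
  -- `b` lies on the increasing branch of `h 1`, at a level strictly between the minimum and `-q`
  obtain ⟨m, hm⟩ : ∃ m, h 1 m < -q - 7 / 8 * σ :=
    exists_lt_of_ciInf_lt (hmin.trans_lt (by linarith))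
  obtain ⟨b, hmb, hb⟩ : ∃ b, m ≤ b ∧ h 1 b = -q - σ / 2 := by
    obtain ⟨R, hR⟩ := hcoer (-q - σ / 2)
    have h1 := hR 1 h1I (max |R| m) ((le_abs_self R).trans ((le_max_left _ _).trans (le_abs_self _)))
    obtain ⟨b, hb, hb'⟩ := intermediate_value_Icc (le_max_right |R| m) (hp 1 h1I).continuousOn
      ⟨(by linarith : h 1 m ≤ -q - σ / 2), h1⟩
    exact ⟨b, hb.1, hb'⟩
  have hs_cont : ∀ p, ContinuousWithinAt (fun s => h s p) (Icc 0 1) 1 := fun p =>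
    (hcont.comp (f := fun s : ℝ => (s, p)) (by fun_prop) fun s hs => ⟨hs, trivial⟩) 1 h1I
  obtain ⟨ρ₁, hρ₁, hnear⟩ : ∃ ρ > 0, ∀ s ∈ Icc (0 : ℝ) 1, |s - 1| < ρ →
      h s m < -q - 3 / 4 * σ ∧ -q - 5 / 8 * σ < h s b := by
    have h1 := (hs_cont m).eventually_lt_const (show h 1 m < -q - 3 / 4 * σ by linarith)
    have h2 := (hs_cont b).eventually_const_lt (show -q - 5 / 8 * σ < h 1 b by linarith)
    obtain ⟨ρ, hρ, hρ'⟩ := Metric.mem_nhdsWithin_iff.1 (h1.and h2)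
    exact ⟨ρ, hρ, fun s hs hs1 => hρ' ⟨by rwa [Metric.mem_ball, Real.dist_eq], hs⟩⟩
  obtain ⟨η₀, hη₀, hη₀'⟩ : ∃ η > 0, ∀ r t', |r - τ| < η → |t' - t| < η →
      q + 3 / 4 * σ < 2 * k * (r - t') + deriv θ r + 2 * (r - τ) := by
    have hd : Continuous (deriv θ) := hθ.continuous_deriv le_rfl
    have h1 : Continuous fun y : ℝ × ℝ => 2 * k * (y.1 - y.2) + deriv θ y.1 + 2 * (y.1 - τ) := by
      fun_prop
    have h2 := (h1.tendsto (τ, t)).eventually_const_lt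
      (show q + 3 / 4 * σ < 2 * k * (τ - t) + deriv θ τ + 2 * (τ - τ) by linarith)
    obtain ⟨η, hη, hη'⟩ := Metric.mem_nhds_iff.1 h2
    refine ⟨η, hη, fun r t' h3 h4 => ?_⟩
    have h5 : (r, t') ∈ Metric.ball (τ, t) η := by
      rw [Metric.mem_ball, Prod.dist_eq, Real.dist_eq, Real.dist_eq]
      exact max_lt h3 h4
    exact hη' h5
  obtain ⟨η, hη, hηη₀, hητ, hητ'⟩ : ∃ η > 0, η ≤ η₀ ∧ η ≤ τ - T₀ ∧ η ≤ T - τ :=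
    ⟨min η₀ (min (τ - T₀) (T - τ)), lt_min hη₀ (lt_min (by linarith [hτ.1]) (by linarith [hτ.2])),
      min_le_left _ _, (min_le_right _ _).trans (min_le_left _ _),
      (min_le_right _ _).trans (min_le_right _ _)⟩
  obtain ⟨ρ₂, hρ₂, hUu⟩ := Metric.uniformContinuousOn_iff.1
    ((isCompact_Icc.prod isCompact_Icc).uniformContinuousOn_of_continuous hUc) (η ^ 2 / 4)
    (by positivity)
  have hTT : 0 < T - T₀ := by linarith
  obtain ⟨ρ, hρ, hρρ₁, hρρ₂, hρη, hρk, hρt, hρt'⟩ : ∃ ρ > 0, ρ ≤ ρ₁ ∧ ρ ≤ ρ₂ ∧ ρ ≤ η₀ ∧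
      2 * k * (T - T₀) * ρ ≤ η ^ 2 / 4 ∧ ρ ≤ t - T₀ ∧ ρ ≤ T - t := by
    have e : ∀ x : ℝ, 0 < x → ∀ᶠ η in 𝓝[>] (0 : ℝ), η < x := fun x hx =>
      (eventually_lt_nhds hx).filter_mono nhdsWithin_le_nhds
    obtain ⟨ρ, h⟩ := ((((((e ρ₁ hρ₁).and (e ρ₂ hρ₂)).and (e η₀ hη₀)).and
      (e (η ^ 2 / 4 / (2 * k * (T - T₀))) (by positivity))).and
      ((e (t - T₀) (by linarith [ht.1])).and (e (T - t) (by linarith [ht.2])))).and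
      self_mem_nhdsWithin).exists
    obtain ⟨⟨⟨⟨⟨h1, h2⟩, h3⟩, h4⟩, h5, h6⟩, h7⟩ := h
    refine ⟨ρ, h7, h1.le, h2.le, h3.le, ?_, h5.le, h6.le⟩
    rw [lt_div_iff₀ (by positivity)] at h4
    linarith
  -- one-sided Lipschitz bound, near the vertex, for the sup-convolution in time of `U - θ - (· - τ)²`,
  -- which is then compared with `V`
  have key : ∀ s ∈ Icc (0 : ℝ) 1, |s - 1| < ρ → ∀ t' ∈ Icc T₀ T, |t' - t| < ρ →
      U (1, τ) - θ τ - k * (t' - τ) ^ 2 - b * (1 - s) -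
        (U (1, τ) - V (1, t) - k * (τ - t) ^ 2 - θ τ) ≤ V (s, t') := by
    intro s hs hs1 t' ht'I ht'
    rcases hs.2.eq_or_lt with rfl | hslt
    · have := hmax 1 h1I τ hτI t' ht'I
      linarith
    rw [abs_lt] at hs1
    have hslope : ∀ S ∈ Ioo s 1, ∀ g : ℝ → ℝ, ContDiff ℝ 1 g → ∀ z ∈ Ioo s S ×ˢ Icc T₀ T,
        IsMaxOn (fun y : ℝ × ℝ => U y - (k * (y.2 - t') ^ 2 + θ y.2 + (y.2 - τ) ^ 2) - g y.1)
          (Icc s S ×ˢ Icc T₀ T) z → deriv g z.1 ≤ b := by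
      rintro S ⟨hsS, hS1⟩ g hg ⟨a, r⟩ ⟨⟨hsa, haS⟩, hr⟩ hgmax
      simp only at hsa haS hr ⊢
      have haO : a ∈ Ioo (0 : ℝ) 1 := ⟨by linarith [hs.1], by linarith⟩
      have haI := Ioo_subset_Icc_self haO
      have ha1 : |a - 1| < ρ := by rw [abs_lt]; constructor <;> linarith
      -- the term `(r - τ)²` makes `τ` the only maximizer at `(1, t)`; `r` maximizes at `(a, t')`
      have hrτ : |r - τ| < η := by
        have h1 : U (a, τ) - (k * (τ - t') ^ 2 + θ τ + (τ - τ) ^ 2) - g a ≤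
            U (a, r) - (k * (r - t') ^ 2 + θ r + (r - τ) ^ 2) - g a :=
          isMaxOn_iff.1 hgmax (a, τ) ⟨⟨hsa.le, haS.le⟩, hτI⟩
        have h2 := hmax 1 h1I r hr t htI
        have h3 : ∀ r ∈ Icc T₀ T, |U (a, r) - U (1, r)| < η ^ 2 / 4 := fun r hr => by
          refine hUu _ ⟨haI, hr⟩ _ ⟨h1I, hr⟩ ?_
          rw [Prod.dist_eq, dist_self, Real.dist_eq]
          exact max_lt (ha1.trans_le hρρ₂) hρ₂
        have h4 := (abs_lt.1 (h3 r hr)).2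
        have h5 := (abs_lt.1 (h3 τ hτI)).1
        have h6 : 2 * k * ((t' - t) * (r - τ)) ≤ η ^ 2 / 4 := by
          refine le_trans ?_ hρk
          rw [mul_assoc (2 * k)]
          refine mul_le_mul_of_nonneg_left ?_ (by positivity)
          refine (le_abs_self _).trans ?_
          rw [abs_mul, mul_comm]
          refine mul_le_mul ?_ ht'.le (abs_nonneg _) hTT.le
          rw [abs_le]; constructor <;> linarith [hr.1, hr.2, hτ.1, hτ.2]
        exact abs_lt_of_sq_lt_sq (by linarith [pow_pos hη 2]) hη.le
      have hrO : r ∈ Ioo T₀ T := by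
        rw [abs_lt] at hrτ; constructor <;> linarith [hrτ.1, hrτ.2]
      have hsub := hU (a, r) ⟨haO, mem_openTime_of_mem_Ioo hT hrO⟩
        (fun y => k * (y.2 - t') ^ 2 + θ y.2 + (y.2 - τ) ^ 2 + g y.1)
        ⟨by
          have := hθ.comp (contDiff_snd (E := ℝ) (F := ℝ))
          have := hg.comp (contDiff_fst (E := ℝ) (F := ℝ))
          exact ContDiff.contDiffAt (by fun_prop), by
          refine Filter.Eventually.filter_mono nhdsWithin_le_nhds ?_
          filter_upwards [prod_mem_nhds (Icc_mem_nhds hsa haS) (Icc_mem_nhds hrO.1 hrO.2)]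
            with y hy
          have := isMaxOn_iff.1 hgmax y hy
          simp only at this ⊢
          linarith⟩
      have htm : HasDerivAt (fun x : ℝ => k * (x - t') ^ 2 + θ x + (x - τ) ^ 2 + g a)
          (2 * k * (r - t') + deriv θ r + 2 * (r - τ)) r := by
        have hd : HasDerivAt θ (deriv θ r) r :=
          (hθ.differentiable one_ne_zero).differentiableAt.hasDerivAt
        have := (((hasDerivAt_mul_sub_sq k t' r).add hd).add
          (hasDerivAt_mul_sub_sq 1 τ r)).add_const (g a)
        simpa using this
      simp only [timeDeriv, spaceDeriv, deriv_const_add] at hsub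
      rw [htm.deriv] at hsub
      have h1 := hη₀' r t' (hrτ.trans_le hηη₀) (ht'.trans_le hρη)
      obtain ⟨h2, h3⟩ := hnear a haI (ha1.trans_le hρρ₁)
      -- by convexity `h a` is above `h a b` to the right of `b`, since `h a m < h a b`
      by_contra! hcon
      have h4 := (hconv a haI).le_max_of_mem_Icc (mem_univ m) (mem_univ (deriv g a))
        ⟨hmb, hcon.le⟩
      rcases le_max_iff.1 h4 with h5 | h5 <;> linarith
    obtain ⟨r', hr', hle⟩ := exists_le_add_mul_of_slope_le hslt isCompact_Icc
      (F := fun y : ℝ × ℝ => U y - (k * (y.2 - t') ^ 2 + θ y.2 + (y.2 - τ) ^ 2))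
      ((hUc.mono (prod_mono (Icc_subset_Icc_left hs.1) le_rfl)).sub
        (by have := hθ.continuous; fun_prop)) hslope hτI
    have := hmax s hs r' hr' t' ht'I
    simp only [sub_self] at hle
    linarith [sq_nonneg (r' - τ)]
  refine ⟨fun y => -(k * (y.2 - τ) ^ 2) - b * (1 - y.1),
    ⟨ContDiff.contDiffAt (by fun_prop), ?_⟩, ?_⟩
  · have hnhds : Metric.ball (1 : ℝ) ρ ×ˢ Metric.ball t ρ ∈ 𝓝 ((1 : ℝ), t) :=
      prod_mem_nhds (Metric.ball_mem_nhds _ hρ) (Metric.ball_mem_nhds _ hρ)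
    filter_upwards [self_mem_nhdsWithin, nhdsWithin_le_nhds hnhds] with y hy hy'
    have hy2 : |y.2 - t| < ρ := by simpa [Real.dist_eq] using hy'.2
    have hy2' := abs_lt.1 hy2
    have := key y.1 hy.1 (by simpa [Real.dist_eq] using hy'.1) y.2
      ⟨by linarith, by linarith⟩ hy2
    simp only [Prod.mk.eta] at this ⊢
    linarith
  · have htm : HasDerivAt (fun x : ℝ => -(k * (x - τ) ^ 2) - b * (1 - 1)) q t := by
      refine (((hasDerivAt_mul_sub_sq k τ t).neg).sub_const _).congr_deriv ?_
      rw [hq]; ring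
    have hsp : HasDerivAt (fun x : ℝ => -(k * (t - τ) ^ 2) - b * (1 - x)) b 1 := by
      refine ((((hasDerivAt_id (1 : ℝ)).const_sub 1).const_mul b).const_sub _).congr_deriv ?_
      ring
    simp only [timeDeriv, spaceDeriv]
    rw [htm.deriv, hsp.deriv, hb]
    linarith

/-- The infimum and the supremum in `arcBound` range over sets that are bounded below and above
respectively, so that neither takes a junk value. -/
theorem ciInf_le_of_le_arcBound {h : ℝ → ℝ → ℝ}
    (hcont : ContinuousOn (fun z : ℝ × ℝ => h z.1 z.2) (Icc 0 1 ×ˢ univ))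
    (hcoer : ∀ K : ℝ, ∃ R : ℝ, ∀ s ∈ Icc (0 : ℝ) 1, ∀ p, R ≤ |p| → K ≤ h s p)
    {a : ℝ} (ha : a ≤ arcBound h) {s : ℝ} (hs : s ∈ Icc (0 : ℝ) 1) : ⨅ p, h s p ≤ -a := by
  have hbelow : ∀ s ∈ Icc (0 : ℝ) 1, BddBelow (range (h s)) := by
    intro s hs
    obtain ⟨R, hR⟩ := hcoer 0
    obtain ⟨B, hB⟩ := (isCompact_Icc.image_of_continuousOn (s := Icc (-R) R) (f := h s)
      ((hcont.comp (f := fun p : ℝ => (s, p)) (by fun_prop) fun p _ => ⟨hs, trivial⟩) )).bddBelow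
    refine ⟨min B 0, ?_⟩
    rintro _ ⟨p, rfl⟩
    rcases le_total R |p| with hp | hp
    · exact (min_le_right _ _).trans (hR s hs p hp)
    · exact (min_le_left _ _).trans (hB ⟨p, abs_le.1 hp, rfl⟩)
  have habove : BddAbove (range fun s : Icc (0 : ℝ) 1 => ⨅ p, h s p) := by
    obtain ⟨B, hB⟩ := (isCompact_Icc.image_of_continuousOn (s := Icc (0 : ℝ) 1)
      (f := fun s => h s 0)
      (hcont.comp (f := fun s : ℝ => (s, (0 : ℝ))) (by fun_prop) fun s hs => ⟨hs, trivial⟩)).bddAbove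
    refine ⟨B, ?_⟩
    rintro _ ⟨s, rfl⟩
    exact (ciInf_le (hbelow s s.2) 0).trans (hB ⟨s, s.2, rfl⟩)
  have h1 := le_ciSup habove ⟨s, hs⟩
  unfold arcBound at ha
  simp only at h1
  linarith

/-! ### Maxima on the network -/

theorem EmbeddedNetwork.isCompact_support {N : ℕ} {E : Type*} (Γ : EmbeddedNetwork N E) :
    IsCompact Γ.support := by
  have := Γ.finite
  exact isCompact_iUnion fun e => isCompact_Icc.image_of_continuousOn (Γ.contDiffOn e).continuousOn

theorem EmbeddedNetwork.curve_mem_support {N : ℕ} {E : Type*} (Γ : EmbeddedNetwork N E) (e : E)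
    {s : ℝ} (hs : s ∈ Icc (0 : ℝ) 1) : Γ.curve e s ∈ Γ.support :=
  mem_iUnion.2 ⟨e, s, hs, rfl⟩

theorem continuousOn_alongArc {N : ℕ} {E : Type*} (Γ : EmbeddedNetwork N E)
    {w : EuclideanSpace ℝ (Fin N) × ℝ → ℝ} {J : Set ℝ} (hw : ContinuousOn w (Γ.support ×ˢ J))
    (e : E) : ContinuousOn (alongArc Γ w e) (Icc 0 1 ×ˢ J) := by
  refine hw.comp (f := fun z : ℝ × ℝ => (Γ.curve e z.1, z.2)) ?_ fun z hz =>
    ⟨Γ.curve_mem_support e hz.1, hz.2⟩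
  exact ((Γ.contDiffOn e).continuousOn.comp continuousOn_fst fun z hz => hz.1).prodMk
    continuousOn_snd

/-- Reduction to a single arc: `u (x, r₁) - v (x, r₂) - k (r₁ - r₂)² - θ r₁` has no maximum on the
network with both times in the interior of `[T₀, T]`. -/
theorem false_of_max {N : ℕ} {E : Type*} {Γ : EmbeddedNetwork N E}
    {H : E → ℝ → ℝ → ℝ} (hH : IsHamiltonian Γ H)
    {c : EuclideanSpace ℝ (Fin N) → ℝ} (hc : IsFluxLimiter Γ H c)
    {T₀ T : ℝ} {T₁ : EReal} (hT : (T : EReal) < T₁)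
    {u v : EuclideanSpace ℝ (Fin N) × ℝ → ℝ}
    (hu : IsSubsolution Γ H c T₀ T₁ u) (hv : IsSupersolution Γ H c T₀ T₁ v)
    {θ : ℝ → ℝ} (hθ : ContDiff ℝ 1 θ) {σ : ℝ} (hσ : 0 < σ)
    (hθσ : ∀ r ∈ Icc T₀ T, σ ≤ deriv θ r) {k : ℝ} (hk : 0 < k)
    {x₀ : EuclideanSpace ℝ (Fin N)} (hx₀ : x₀ ∈ Γ.support)
    {τ t : ℝ} (hτ : τ ∈ Ioo T₀ T) (ht : t ∈ Ioo T₀ T)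
    (hmax : ∀ x ∈ Γ.support, ∀ r₁ ∈ Icc T₀ T, ∀ r₂ ∈ Icc T₀ T,
      u (x, r₁) - v (x, r₂) - k * (r₁ - r₂) ^ 2 - θ r₁ ≤
        u (x₀, τ) - v (x₀, t) - k * (τ - t) ^ 2 - θ τ) : False := by
  have hJ := Icc_subset_halfOpenTime (T₀ := T₀) hT
  have huc := fun e => continuousOn_alongArc Γ (hu.continuousOn.mono (prod_mono le_rfl hJ)) e
  have hvc := fun e => continuousOn_alongArc Γ (hv.continuousOn.mono (prod_mono le_rfl hJ)) e
  by_cases hvert : x₀ ∈ Γ.vertices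
  · have hτI : τ ∈ Icc T₀ T := Ioo_subset_Icc_self hτ
    have htI : t ∈ Icc T₀ T := Ioo_subset_Icc_self ht
    have hθτ : 0 < deriv θ τ := hσ.trans_le (hθσ τ hτI)
    have hq : 2 * k * (τ - t) + deriv θ τ ≤ c x₀ := by
      have h1 := hu.vertex x₀ hvert τ (mem_openTime_of_mem_Ioo hT hτ)
        (fun r => k * (r - t) ^ 2 + θ r) ⟨ContDiff.contDiffAt (by fun_prop), by
          refine Filter.Eventually.filter_mono nhdsWithin_le_nhds ?_
          filter_upwards [Icc_mem_nhds hτ.1 hτ.2] with r hr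
          have := hmax x₀ hx₀ r hr t htI
          linarith⟩
      rwa [((hasDerivAt_mul_sub_sq k t τ).fun_add
        (hθ.differentiable one_ne_zero).differentiableAt.hasDerivAt).deriv] at h1
    obtain ⟨e, he, hφ⟩ := hv.vertex x₀ hvert t (mem_openTime_of_mem_Ioo hT ht)
      ⟨fun r => -(k * (r - τ) ^ 2), ⟨ContDiff.contDiffAt (by fun_prop), by
          refine Filter.Eventually.filter_mono nhdsWithin_le_nhds ?_
          filter_upwards [Icc_mem_nhds ht.1 ht.2] with r hr
          have := hmax x₀ hx₀ τ hτI r hr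
          linarith⟩, by
          rw [(hasDerivAt_mul_sub_sq k τ t).fun_neg.deriv]
          linarith⟩
    have he1 : Γ.curve e 1 = x₀ := he
    have hmin := ciInf_le_of_le_arcBound (hH.continuousOn e) (hH.coercive e) (hc x₀ hvert e he)
      (right_mem_Icc.2 zero_le_one)
    obtain ⟨φ, hφ1, hφ2⟩ := exists_subtangent_of_vertex_max (V := alongArc Γ v e)
      (hH.continuousOn e) (hH.convex e) (hH.coercive e) hT (huc e) (hu.arc e) hθ hk hτ ht hθτ
      (hmin.trans (by linarith)) (by
        intro s hs r₁ hr₁ r₂ hr₂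
        simpa only [alongArc, he1] using hmax _ (Γ.curve_mem_support e hs) r₁ hr₁ r₂ hr₂)
    exact absurd (hφ φ hφ1) (not_le.2 hφ2)
  · obtain ⟨e, s, hs, rfl⟩ := mem_iUnion.1 hx₀
    have hs0 : s ≠ 0 := by rintro rfl; exact hvert ⟨e, .inl rfl⟩
    have hs1 : s ≠ 1 := by rintro rfl; exact hvert ⟨e, .inr rfl⟩
    exact false_of_interior_max (hH.continuousOn e) (hH.coercive e) hT (huc e) (hvc e)
      (hu.arc e) (hv.arc e) hθ hσ hθσ hk ⟨hs.1.lt_of_ne' hs0, hs.2.lt_of_ne hs1⟩ hτ ht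
      fun s' hs' => hmax _ (Γ.curve_mem_support e hs')

end HJNetwork

open HJNetwork in
theorem theorem6p1 {N : ℕ} {E : Type*} (Γ : HJNetwork.EmbeddedNetwork N E)
    (H : E → ℝ → ℝ → ℝ) (hH : HJNetwork.IsHamiltonian Γ H)
    (c : EuclideanSpace ℝ (Fin N) → ℝ) (hc : HJNetwork.IsFluxLimiter Γ H c)
    (T₀ : ℝ) (T₁ : EReal) (hT₀ : 0 ≤ T₀) (hT : (T₀ : EReal) < T₁)
    (u v : EuclideanSpace ℝ (Fin N) × ℝ → ℝ)
    (hu_uc : UniformContinuousOn u (Γ.support ×ˢ HJNetwork.halfOpenTime T₀ T₁))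
    (hv_uc : UniformContinuousOn v (Γ.support ×ˢ HJNetwork.halfOpenTime T₀ T₁))
    (hu : HJNetwork.IsSubsolution Γ H c T₀ T₁ u)
    (hv : HJNetwork.IsSupersolution Γ H c T₀ T₁ v)
    (h_init : ∀ x ∈ Γ.support, u (x, T₀) ≤ v (x, T₀)) :
    ∀ x ∈ Γ.support, ∀ t ∈ HJNetwork.halfOpenTime T₀ T₁, u (x, t) ≤ v (x, t) := by
  intro x hx t ht
  by_contra! hlt
  set m := u (x, t) - v (x, t) with hm
  have hm0 : 0 < m := by rw [hm]; linarith
  have hTt : T₀ < t := by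
    rcases ht.1.lt_or_eq with h | h
    · exact h
    · subst h; exact absurd (h_init x hx) (not_le.2 hlt)
  obtain ⟨T, htT, hTT₁⟩ : ∃ T : ℝ, t < T ∧ (T : EReal) < T₁ := by
    obtain ⟨T, h1, h2⟩ := EReal.lt_iff_exists_real_btwn.1 ht.2
    exact ⟨T, EReal.coe_lt_coe_iff.1 h1, h2⟩
  obtain ⟨T₂, htT₂, hT₂⟩ := exists_between htT
  have hJ := Icc_subset_halfOpenTime (T₀ := T₀) hTT₁
  have hcD : IsCompact (Γ.support ×ˢ (Icc T₀ T ×ˢ Icc T₀ T)) :=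
    Γ.isCompact_support.prod (isCompact_Icc.prod isCompact_Icc)
  have htI : t ∈ Icc T₀ T := ⟨hTt.le, htT.le⟩
  have hT₀I : T₀ ∈ Icc T₀ T := ⟨le_rfl, (hTt.trans htT).le⟩
  have hdiff : ContinuousOn (fun z : EuclideanSpace ℝ (Fin N) × (ℝ × ℝ) =>
      u (z.1, z.2.1) - v (z.1, z.2.2)) (Γ.support ×ˢ (Icc T₀ T ×ˢ Icc T₀ T)) :=
    (hu.continuousOn.comp (f := fun z : EuclideanSpace ℝ (Fin N) × (ℝ × ℝ) => (z.1, z.2.1))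
      (by fun_prop) fun z hz => ⟨hz.1, hJ hz.2.1⟩).sub
    (hv.continuousOn.comp (f := fun z : EuclideanSpace ℝ (Fin N) × (ℝ × ℝ) => (z.1, z.2.2))
      (by fun_prop) fun z hz => ⟨hz.1, hJ hz.2.2⟩)
  obtain ⟨B, hB0, hB⟩ : ∃ B > 0, ∀ x ∈ Γ.support, ∀ r₁ ∈ Icc T₀ T, ∀ r₂ ∈ Icc T₀ T,
      u (x, r₁) - v (x, r₂) ≤ B := by
    obtain ⟨B, hB⟩ := (hcD.image_of_continuousOn hdiff).bddAbove
    refine ⟨max B 1, lt_max_of_lt_right one_pos, fun x hx r₁ hr₁ r₂ hr₂ => le_max_of_le_left ?_⟩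
    exact hB ⟨(x, r₁, r₂), ⟨hx, hr₁, hr₂⟩, rfl⟩
  -- `θ` is at most `m / 2` at the time `t`, and exceeds `B` after `T₂`
  set A := 2 * B / (m * (T₂ - t)) with hA
  have hTt₂ : 0 < T₂ - t := by linarith
  have hA0 : 0 < A := by positivity
  set θ : ℝ → ℝ := fun r => m / 2 * Real.exp (A * (r - t)) with hθ
  have hθd : ∀ r, deriv θ r = m / 2 * (Real.exp (A * (r - t)) * A) := by
    intro r
    have h1 : HasDerivAt (fun s => A * (s - t)) A r := by
      simpa using ((hasDerivAt_id r).sub_const t).const_mul A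
    exact (h1.exp.const_mul (m / 2)).deriv
  have hθpos : ∀ r, 0 < θ r := fun r => by positivity
  have hθT : ∀ r, T₂ ≤ r → B < θ r := by
    intro r hr
    have h1 := Real.add_one_le_exp (A * (r - t))
    have h2 : A * (T₂ - t) ≤ A * (r - t) := by gcongr
    have h3 : m / 2 * (A * (T₂ - t)) = B := by rw [hA]; field_simp
    have h4 : m / 2 * (A * (T₂ - t)) < m / 2 * Real.exp (A * (r - t)) :=
      mul_lt_mul_of_pos_left (by linarith) (by positivity)
    simp only [hθ]
    linarith
  obtain ⟨ρ₁, hρ₁, hu'⟩ := Metric.uniformContinuousOn_iff.1 hu_uc (m / 2) (by positivity)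
  obtain ⟨ρ₂, hρ₂, hv'⟩ := Metric.uniformContinuousOn_iff.1 hv_uc (m / 2) (by positivity)
  obtain ⟨ρ, hρ, hρρ₁, hρρ₂, hρT⟩ : ∃ ρ > 0, ρ ≤ ρ₁ ∧ ρ ≤ ρ₂ ∧ ρ ≤ T - T₂ :=
    ⟨min ρ₁ (min ρ₂ (T - T₂)), lt_min hρ₁ (lt_min hρ₂ (by linarith)), min_le_left _ _,
      (min_le_right _ _).trans (min_le_left _ _), (min_le_right _ _).trans (min_le_right _ _)⟩
  set k := B / ρ ^ 2 with hk
  have hk0 : 0 < k := by positivity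
  obtain ⟨⟨x₀, τ, t₀⟩, ⟨hx₀, hτ, ht₀⟩, hz⟩ := hcD.exists_isMaxOn ⟨(x, t, t), hx, htI, htI⟩
    (f := fun z => u (z.1, z.2.1) - v (z.1, z.2.2) - (k * (z.2.1 - z.2.2) ^ 2 + θ z.2.1))
    (hdiff.sub (by fun_prop))
  simp only at hx₀ hτ ht₀
  have hz' : ∀ y ∈ Γ.support, ∀ r₁ ∈ Icc T₀ T, ∀ r₂ ∈ Icc T₀ T,
      u (y, r₁) - v (y, r₂) - (k * (r₁ - r₂) ^ 2 + θ r₁) ≤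
        u (x₀, τ) - v (x₀, t₀) - (k * (τ - t₀) ^ 2 + θ τ) :=
    fun y hy r₁ hr₁ r₂ hr₂ => isMaxOn_iff.1 hz (y, r₁, r₂) ⟨hy, hr₁, hr₂⟩
  have hge : m / 2 ≤ u (x₀, τ) - v (x₀, t₀) - (k * (τ - t₀) ^ 2 + θ τ) := by
    have h1 := hz' x hx t htI t htI
    have h2 : θ t = m / 2 := by simp [hθ]
    rw [h2, sub_self] at h1
    linarith
  have hBz := hB x₀ hx₀ τ hτ t₀ ht₀
  have hθτ := hθpos τ
  have hksq := mul_nonneg hk0.le (sq_nonneg (τ - t₀))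
  -- `k ρ² = B` keeps the two times close
  have hclose : |τ - t₀| < ρ := by
    have h1 : k * ρ ^ 2 = B := by rw [hk]; field_simp
    exact abs_lt_of_sq_lt_sq (lt_of_mul_lt_mul_left (by linarith) hk0.le) hρ.le
  have hτT₂ : τ < T₂ := by
    by_contra! hcon
    linarith [hθT τ hcon]
  have ht₀T : t₀ < T := by linarith [(abs_lt.1 hclose).1]
  -- close to the initial time the initial inequality and uniform continuity are in force
  have hτ0 : T₀ < τ := by
    rcases hτ.1.lt_or_eq with h | h
    · exact h
    · subst h
      have h1 := hv' (x₀, T₀) ⟨hx₀, hJ hτ⟩ (x₀, t₀) ⟨hx₀, hJ ht₀⟩ (by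
        rw [Prod.dist_eq, dist_self, Real.dist_eq]
        exact max_lt hρ₂ (hclose.trans_le hρρ₂))
      rw [Real.dist_eq] at h1
      linarith [(abs_lt.1 h1).2, h_init x₀ hx₀]
  have ht₀0 : T₀ < t₀ := by
    rcases ht₀.1.lt_or_eq with h | h
    · exact h
    · subst h
      have h1 := hu' (x₀, τ) ⟨hx₀, hJ hτ⟩ (x₀, T₀) ⟨hx₀, hJ ht₀⟩ (by
        rw [Prod.dist_eq, dist_self, Real.dist_eq]
        exact max_lt hρ₁ (hclose.trans_le hρρ₁))
      rw [Real.dist_eq] at h1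
      linarith [(abs_lt.1 h1).2, h_init x₀ hx₀]
  refine false_of_max hH hc hTT₁ hu hv (θ := θ) (by fun_prop)
    (σ := m / 2 * (Real.exp (A * (T₀ - t)) * A)) (by positivity) ?_ hk0 hx₀
    ⟨hτ0, hτT₂.trans hT₂⟩ ⟨ht₀0, ht₀T⟩ ?_
  · intro r hr
    rw [hθd]
    have := hr.1
    gcongr
  · intro y hy r₁ hr₁ r₂ hr₂
    linarith [hz' y hy r₁ hr₁ r₂ hr₂]
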